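/- **Theorem.** There is a finite planar graph $G$ with $\mathrm{HG}_1(G)\ge 22$; in other words, $\mathrm{HG}_1(\mathcal{P}lanar)=\sup\{\mathrm{HG}_1(G): G \text{ a finite planar graph}\}\ge 22$. Here $\mathrm{HG}_s(G)$ is the hat guessing number of a finite simple graph $G$ with $s$ guesses per sage, defined through the following game. A sage sits at each vertex of $G$. An adversary gives each sage a hat whose color is chosen arbitrarily from the same $k$ colors. Each sage sees exactly the hats at the adjacent vertices (not the sage's own hat), and all sages simultaneously write down $s$ guesses for the colors of their own hats; the guesses of the sage at $v$ are determined by the hat colors at the neighbors of $v$ according to a deterministic strategy fixed in advance. The strategy is winning if, for every assignment of hat colors, at least one sage has the color of his own hat among his guesses. $\mathrm{HG}_s(G)$ is the largest $k$ for which a winning strategy exists. -/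

import Mathlib

namespace HatGuessing

/-- A deterministic strategy of the sages in the hat guessing game `⟨G, h, g⟩`. The hat colours of
the sage at `v` are the elements of `Fin (h v)`. That sage sees exactly the hats on the vertices
adjacent to `v` and, depending on them alone, writes down a list of `g v` colours; since repetitions
in the list are irrelevant, the list is recorded as a set of at most `g v` colours. -/
structure Strategy {V : Type*} (G : SimpleGraph V) (h g : V → ℕ) where
  guess : ∀ v : V, (∀ u : G.neighborSet v, Fin (h u)) → Finset (Fin (h v))
  card_guess_le : ∀ (v : V) (seen : ∀ u : G.neighborSet v, Fin (h u)), (guess v seen).card ≤ g v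

/-- A strategy is winning if for every placement of hats at least one sage has the colour of the own
hat among the guesses. -/
def Strategy.IsWinning {V : Type*} {G : SimpleGraph V} {h g : V → ℕ} (σ : Strategy G h g) : Prop :=
  ∀ hat : (∀ v : V, Fin (h v)), ∃ v : V, hat v ∈ σ.guess v (fun u => hat u)

/-- The game `⟨G, h, g⟩` is winning if the sages have a winning strategy. -/
def IsWinningGame {V : Type*} (G : SimpleGraph V) (h g : V → ℕ) : Prop :=
  ∃ σ : Strategy G h g, σ.IsWinning

/-- The hat guessing number `HG_s(G)`: the largest `k` such that the game with `k` colours and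
`s` guesses at every vertex of `G` is winning. The value is taken in `ℕ∞`, so that the supremum
is never a default value. -/
noncomputable def hatGuessingNumber {V : Type*} (s : ℕ) (G : SimpleGraph V) : ℕ∞ :=
  ⨆ (k : ℕ) (_ : IsWinningGame G (fun _ => k) (fun _ => s)), (k : ℕ∞)

/-- The hat guessing number `HG_s(C)` of a class `C` of finite graphs: the supremum of `HG_s(G)`
over the graphs `G` in the class. -/
noncomputable def hatGuessingNumberOfClass (s : ℕ) (C : ∀ V : Type, SimpleGraph V → Prop) : ℕ∞ :=
  ⨆ (V : Type) (_ : Finite V) (G : SimpleGraph V) (_ : C V G), hatGuessingNumber s G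

/-- A drawing of a graph in the plane without crossings: the vertices are distinct points, every
edge is a simple arc that joins the points of its two ends and contains no other vertex, and
the arcs of two different edges have no interior point in common. -/
structure PlaneDrawing {V : Type*} (G : SimpleGraph V) where
  point : V → ℝ × ℝ
  point_injective : Function.Injective point
  arc : G.edgeSet → unitInterval → ℝ × ℝ
  arc_continuous : ∀ e : G.edgeSet, Continuous (arc e)
  arc_injective : ∀ e : G.edgeSet, Function.Injective (arc e)
  arc_ends : ∀ e : G.edgeSet, s(arc e 0, arc e 1) = Sym2.map point (e : Sym2 V)
  arc_ne_point : ∀ (e : G.edgeSet) (t : unitInterval), t ∈ Set.Ioo 0 1 →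
    ∀ v : V, arc e t ≠ point v
  arc_ne_arc : ∀ e f : G.edgeSet, e ≠ f → ∀ t u : unitInterval, t ∈ Set.Ioo 0 1 →
    u ∈ Set.Ioo 0 1 → arc e t ≠ arc f u

/-- A graph is planar if it can be drawn in the plane without crossings. -/
def IsPlanar {V : Type*} (G : SimpleGraph V) : Prop :=
  Nonempty (PlaneDrawing G)

end HatGuessing

/-! The graph is an edge joined to a long path. On ten path vertices, six guesses per sage win with
22 colours (`exists_isPathRule`). Six guesses can be traded for one: each block of ten vertices is
devoted to a 6-tuple of colour pairs on the edge and plays guess `j` when it sees the `j`-th pair.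
For fixed hats on the path, six distinct pairs cannot all make every path guess wrong, since the
block of that 6-tuple contains a right guess for one of them (`card_alivePairs_lt`).

Both ends of the edge see the path, so they know the at most five surviving pairs. Each end sees the
other's hat and can guess one point on each line of the colour grid; by Hall's theorem five points
are covered this way (`exists_line_assignment`). -/

namespace HatGuessing

/-! ### Strategies as local rules -/

/-- A single-guess strategy may be given as a function of the whole hat placement whose value at each
vertex depends only on the hats of the neighbours. -/
theorem isWinningGame_of_local {V : Type*} {G : SimpleGraph V} {k : ℕ} [NeZero k]
    (F : (V → Fin k) → V → Fin k)
    (hlocal : ∀ v x y, (∀ u, G.Adj v u → x u = y u) → F x v = F y v)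
    (hwin : ∀ x, ∃ v, x v = F x v) :
    IsWinningGame G (fun _ => k) (fun _ => 1) := by
  classical
  -- Unseen hats are replaced by 0, which `hlocal` makes harmless.
  refine ⟨⟨fun v seen => {F (fun u => if h : G.Adj v u then seen ⟨u, h⟩ else 0) v},
    fun v seen => by simp⟩, fun hat => ?_⟩
  obtain ⟨v, hv⟩ := hwin hat
  refine ⟨v, Finset.mem_singleton.2 (hv.trans (hlocal v _ _ fun u hu => ?_))⟩
  simp [hu]

/-! ### Six guesses and twenty-two colours on a path of ten vertices -/

/-- `deadSet i` is the set of differences `c - d` such that a sage number `i - 1` with hat `c` and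
right neighbour with hat `d` is ruled out by the guesses of the sages up to that one. -/
def deadSet : ℕ → Finset (Fin 22)
  | 0 => ∅
  | 1 => {0, 1, 2, 3, 4, 5}
  | 2 => {0, 3, 6, 9, 11, 14, 17, 20}
  | 3 => {0, 1, 2, 3, 4, 5, 6, 7, 8}
  | 4 => {0, 2, 4, 6, 8, 11, 13, 15, 17, 19}
  | 5 => {0, 2, 4, 6, 8, 10, 12, 14, 16, 18, 20}
  | 6 => {1, 3, 5, 7, 9, 10, 12, 14, 16, 18, 20, 21}
  | 7 => {9, 10, 11, 12, 13, 14, 15, 16, 17, 18, 19, 20, 21}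
  | 8 => {1, 2, 4, 5, 7, 8, 10, 12, 13, 15, 16, 18, 19, 21}
  | 9 => {6, 7, 8, 9, 10, 11, 12, 13, 14, 15, 16, 17, 18, 19, 20, 21}
  | _ => Finset.univ

/-- The guesses of sage number `i` on the path whose neighbours have hats `p` and `n`. -/
def pathGuess (i : ℕ) (p n : Fin 22) : Finset (Fin 22) :=
  {c | c - n ∈ deadSet (i + 1) ∧ p - c ∉ deadSet i}

/-- On average over `p` the size is |D_{i+1}|(22 - |D_i|)/22, where D_i is `deadSet i`. The sizes 0,
6, 8, 9, 10, 11, 12, 13, 14, 16, 22 are each the largest that keep this at most 6 given the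
preceding one; the sets are spread so that no single `p` exceeds 6. -/
theorem card_pathGuess_zero_le : ∀ i < 10, ∀ p, (pathGuess i p 0).card ≤ 6 := by
  decide +kernel

/-- Translating all hats by `n` reduces to `n = 0`. -/
theorem card_pathGuess_le {i : ℕ} (hi : i < 10) (p n : Fin 22) : (pathGuess i p n).card ≤ 6 := by
  refine le_of_eq_of_le ?_ (card_pathGuess_zero_le i hi (p - n))
  refine Finset.card_equiv (Equiv.subRight n) fun c => ?_
  simp [pathGuess]

/-- Wrong guesses propagate the avoidance of `deadSet i` from `deadSet 0`, which is empty, to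
`deadSet 10`, which is everything. -/
theorem exists_mem_pathGuess (x : ℕ → Fin 22) :
    ∃ i < 10, x (i + 1) ∈ pathGuess i (x i) (x (i + 2)) := by
  by_contra! h
  have key : ∀ i ≤ 10, x i - x (i + 1) ∉ deadSet i := by
    intro i
    induction i with
    | zero => simp [deadSet]
    | succ i ih =>
      intro hi hmem
      exact h i (by omega) (by simpa [pathGuess] using ⟨hmem, ih (by omega)⟩)
  exact key 10 le_rfl (Finset.mem_univ _)

/-- A rule for `s` guesses per sage with `k` colours on a path of `n` vertices: sage number `i` sees
the hats of the two neighbours and makes the guesses `q i p d j`, and someone is always right. The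
hats at positions `0` and `n + 1`, next to the ends of the path, are arbitrary. -/
def IsPathRule (k n s : ℕ) (q : ℕ → Fin k → Fin k → Fin s → Fin k) : Prop :=
  ∀ x : ℕ → Fin k, ∃ i < n, ∃ j, x (i + 1) = q i (x i) (x (i + 2)) j

theorem exists_fin_cover {α : Type*} [Nonempty α] {s : ℕ} (S : Finset α) (hS : S.card ≤ s) :
    ∃ f : Fin s → α, ∀ a ∈ S, ∃ j, a = f j := by
  classical
  refine ⟨fun j => if h : (j : ℕ) < S.card then S.equivFin.symm ⟨j, h⟩ else Classical.arbitrary α,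
    fun a ha => ⟨⟨S.equivFin ⟨a, ha⟩, (S.equivFin ⟨a, ha⟩).2.trans_le hS⟩, ?_⟩⟩
  simp

theorem exists_isPathRule : ∃ q, IsPathRule 22 10 6 q := by
  have h : ∀ i p n, ∃ f : Fin 6 → Fin 22, i < 10 → ∀ c ∈ pathGuess i p n, ∃ j, c = f j := by
    intro i p n
    by_cases hi : i < 10
    · obtain ⟨f, hf⟩ := exists_fin_cover _ (card_pathGuess_le hi p n)
      exact ⟨f, fun _ => hf⟩
    · exact ⟨fun _ => 0, fun h => absurd h hi⟩
  choose q hq using h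
  refine ⟨q, fun x => ?_⟩
  obtain ⟨i, hi, hx⟩ := exists_mem_pathGuess x
  exact ⟨i, hi, hq i _ _ hi _ hx⟩

/-! ### Five points in a grid -/

/-- At most five points of a grid can be assigned to the lines through them, at most one to each
line. -/
theorem exists_line_assignment {α β : Type*} [Nonempty α] [Nonempty β] (P : Finset (α × β))
    (hP : P.card ≤ 5) :
    ∃ (f : β → α) (g : α → β), ∀ p ∈ P, p.1 = f p.2 ∨ p.2 = g p.1 := by
  classical
  -- `Sum.inl a` stands for the line with first coordinate `a`, on which `g a` selects a point;
  -- `Sum.inr b` for the line with second coordinate `b`, served by `f b`.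
  let t : P → Finset (α ⊕ β) := fun p => {Sum.inl p.1.1, Sum.inr p.1.2}
  have hall : ∀ Q : Finset P, Q.card ≤ (Q.biUnion t).card := by
    intro Q
    set R := Q.image fun p => p.1.1
    set C := Q.image fun p => p.1.2
    have h1 : Q.biUnion t = R.disjSum C := by
      ext z
      rcases z with z | z <;> simp [t, R, C, eq_comm]
    have h2 : Q.card ≤ R.card * C.card := by
      rw [← Finset.card_product, ← Finset.card_image_of_injective Q Subtype.val_injective]
      refine Finset.card_le_card fun p hp => ?_
      obtain ⟨q, hq, rfl⟩ := Finset.mem_image.1 hp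
      exact Finset.mem_product.2 ⟨Finset.mem_image_of_mem _ hq, Finset.mem_image_of_mem _ hq⟩
    have h3 : Q.card ≤ 5 := (Finset.card_le_univ Q).trans (by simpa using hP)
    rw [h1, Finset.card_disjSum]
    -- A failure of Hall's condition needs r + c < |Q| ≤ rc with r + c ≤ 4, which is impossible. Six
    -- points in a 2 × 3 grid would fail.
    by_contra! hlt
    have hR : R.card ≤ 4 := by omega
    have hC : C.card ≤ 4 := by omega
    interval_cases R.card <;> interval_cases C.card <;> omega
  obtain ⟨F, hinj, hF⟩ := (Finset.all_card_le_biUnion_card_iff_exists_injective t).1 hall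
  refine ⟨fun b => if h : ∃ p : P, F p = Sum.inr b then h.choose.1.1 else Classical.arbitrary α,
    fun a => if h : ∃ p : P, F p = Sum.inl a then h.choose.1.2 else Classical.arbitrary β,
    fun p hp => ?_⟩
  have hmem := hF ⟨p, hp⟩
  simp only [t, Finset.mem_insert, Finset.mem_singleton] at hmem
  rcases hmem with h | h
  · right
    have hex : ∃ q : P, F q = Sum.inl p.1 := ⟨_, h⟩
    have := hinj (hex.choose_spec.trans h.symm)
    simp only [dif_pos hex, this]
  · left
    have hex : ∃ q : P, F q = Sum.inr p.2 := ⟨_, h⟩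
    have := hinj (hex.choose_spec.trans h.symm)
    simp only [dif_pos hex, this]

/-! ### The join of an edge and a path -/

/-- The join of an edge and a path of `N` vertices. -/
def edgeJoinPath (N : ℕ) : SimpleGraph (Bool ⊕ Fin N) where
  Adj
    | .inl a, .inl b => a ≠ b
    | .inl _, .inr _ => True
    | .inr _, .inl _ => True
    | .inr i, .inr j => (i : ℕ) + 1 = j ∨ (j : ℕ) + 1 = i
  symm := ⟨by
    rintro (a | i) (b | j) h
    · exact Ne.symm h
    · trivial
    · trivial
    · exact Or.symm h⟩
  loopless := ⟨by
    rintro (a | i) h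
    · exact h rfl
    · rcases h with h | h <;> omega⟩

/-- The hats on a path of `N` vertices, moved to the positions `1, …, N` and extended by `0`. -/
def extendHats {k N : ℕ} [NeZero k] (y : Fin N → Fin k) : ℕ → Fin k
  | 0 => 0
  | i + 1 => if h : i < N then y ⟨i, h⟩ else 0

theorem extendHats_succ {k N : ℕ} [NeZero k] (y : Fin N → Fin k) (w : Fin N) :
    extendHats y (w + 1) = y w := by
  simp [extendHats]

theorem extendHats_congr {k N : ℕ} [NeZero k] {y z : Fin N → Fin k} {i : ℕ}
    (h : ∀ w : Fin N, (w : ℕ) + 1 = i → y w = z w) : extendHats y i = extendHats z i := by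
  cases i with
  | zero => rfl
  | succ i =>
    simp only [extendHats]
    split_ifs with hi
    · exact h _ rfl
    · rfl

open Classical in
/-- The guess of vertex `w` of the long path. The path is cut into blocks of `n` vertices, one for
each `s`-tuple of pairs of colours; in a block, the `j`-th guess of the path rule is made when the
`j`-th pair of the tuple is seen. -/
noncomputable def blockGuess {k n s M : ℕ} [NeZero k] (q : ℕ → Fin k → Fin k → Fin s → Fin k)
    (e : Fin M → Fin s → Fin k × Fin k) (y : Fin (M * n) → Fin k) (ab : Fin k × Fin k)
    (w : Fin (M * n)) : Fin k :=
  if h : ∃ j, e w.divNat j = ab then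
    q w.modNat (extendHats y w) (extendHats y (w + 2)) h.choose else 0

/-- Vertex `w` sits at position `w + 1`, so positions `w` and `w + 2` hold the hats of its
neighbours. -/
theorem blockGuess_congr {k n s M : ℕ} [NeZero k] (q : ℕ → Fin k → Fin k → Fin s → Fin k)
    (e : Fin M → Fin s → Fin k × Fin k) {y z : Fin (M * n) → Fin k} (ab : Fin k × Fin k)
    (w : Fin (M * n))
    (h : ∀ v : Fin (M * n), (w : ℕ) + 1 = v ∨ (v : ℕ) + 1 = w → y v = z v) :
    blockGuess q e y ab w = blockGuess q e z ab w := by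
  unfold blockGuess
  rw [extendHats_congr fun v hv => h v (Or.inr hv),
    extendHats_congr (y := y) (z := z) (i := w + 2) fun v hv => h v (Or.inl (by omega))]

open Classical in
/-- The pairs of colours at the ends of the edge for which nobody on the path guesses right. -/
noncomputable def alivePairs {k n s M : ℕ} [NeZero k] (q : ℕ → Fin k → Fin k → Fin s → Fin k)
    (e : Fin M → Fin s → Fin k × Fin k) (y : Fin (M * n) → Fin k) : Finset (Fin k × Fin k) :=
  {ab | ∀ w, y w ≠ blockGuess q e y ab w}

theorem card_alivePairs_lt {k n s M : ℕ} [NeZero k] {q : ℕ → Fin k → Fin k → Fin s → Fin k}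
    (hq : IsPathRule k n s q) {e : Fin M → Fin s → Fin k × Fin k} (he : Function.Surjective e)
    (y : Fin (M * n) → Fin k) : (alivePairs q e y).card < s := by
  classical
  by_contra! hs
  obtain ⟨A, hA, hcard⟩ := Finset.exists_subset_card_eq hs
  let f : Fin s ≃ A := (A.equivFinOfCardEq hcard).symm
  -- Block `m` is the one devoted to `s` distinct alive pairs.
  obtain ⟨m, hm⟩ := he fun j => (f j : Fin k × Fin k)
  -- The hats just outside the block belong to adjacent blocks or are the padding 0; the path rule
  -- allows any values there.
  obtain ⟨i, hi, j, hij⟩ := hq fun i => extendHats y (i + n * m)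
  have halive : (f j : Fin k × Fin k) ∈ alivePairs q e y := hA (f j).2
  simp only [alivePairs, Finset.mem_filter, Finset.mem_univ, true_and] at halive
  let w : Fin (M * n) := finProdFinEquiv (m, ⟨i, hi⟩)
  have hval : (w : ℕ) = i + n * m := rfl
  have hdm : (w.divNat, w.modNat) = (m, ⟨i, hi⟩) := finProdFinEquiv.symm_apply_apply _
  have hdiv : w.divNat = m := congrArg Prod.fst hdm
  have hmod : w.modNat = ⟨i, hi⟩ := congrArg Prod.snd hdm
  have hex : ∃ j', e w.divNat j' = f j := ⟨j, by rw [hdiv, hm]⟩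
  -- The pairs of the tuple are distinct, so the chosen index can only be `j`.
  have hj : hex.choose = j := by
    have h := hex.choose_spec
    generalize hex.choose = j' at h
    rw [hdiv, hm] at h
    exact f.injective (Subtype.ext h)
  refine halive w ?_
  rw [blockGuess, dif_pos hex, hj, hmod, ← extendHats_succ y w, hval]
  convert hij using 2 <;> first | rfl | ring_nf

theorem isWinningGame_edgeJoinPath {k n : ℕ} [NeZero k] {q : ℕ → Fin k → Fin k → Fin 6 → Fin k}
    (hq : IsPathRule k n 6 q) :
    ∃ N, IsWinningGame (edgeJoinPath N) (fun _ => k) (fun _ => 1) := by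
  classical
  let e := (Fintype.equivFin (Fin 6 → Fin k × Fin k)).symm
  have hlt := card_alivePairs_lt hq e.surjective
  have hline := fun y => exists_line_assignment (alivePairs q e y) (Nat.le_of_lt_succ (hlt y))
  choose f g hfg using hline
  refine ⟨_, isWinningGame_of_local (fun x v => match v with
    | .inl true => f (fun w => x (.inr w)) (x (.inl false))
    | .inl false => g (fun w => x (.inr w)) (x (.inl true))
    | .inr w => blockGuess q e (fun w => x (.inr w)) (x (.inl true), x (.inl false)) w) ?_ ?_⟩
  · rintro ((_ | _) | w) x y hxy
    · have h1 : (fun w => x (.inr w)) = fun w => y (.inr w) := funext fun w => hxy (.inr w) trivial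
      have h2 := hxy (.inl true) Bool.false_ne_true
      simp only [h1, h2]
    · have h1 : (fun w => x (.inr w)) = fun w => y (.inr w) := funext fun w => hxy (.inr w) trivial
      have h2 := hxy (.inl false) Bool.false_ne_true.symm
      simp only [h1, h2]
    · have h1 := hxy (.inl true) trivial
      have h2 := hxy (.inl false) trivial
      simp only [h1, h2]
      exact blockGuess_congr q e _ w fun v hv => hxy (.inr v) hv
  · intro x
    by_contra! h
    have halive : (x (.inl true), x (.inl false)) ∈ alivePairs q e fun w => x (.inr w) := by
      simp only [alivePairs, Finset.mem_filter, Finset.mem_univ, true_and]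
      exact fun w => h (.inr w)
    exact (hfg _ _ halive).elim (h (.inl true)) (h (.inl false))

/-! ### Planarity -/

/-- A graph drawn with straight edges and without crossings is planar. -/
theorem isPlanar_of_segments {V : Type*} {G : SimpleGraph V} (pt : V → ℝ × ℝ)
    (hpt : Function.Injective pt)
    (hvertex : ∀ u v, G.Adj u v → ∀ w, pt w ∉ openSegment ℝ (pt u) (pt v))
    (hedge : ∀ u v u' v', G.Adj u v → G.Adj u' v' →
      ∀ p, p ∈ openSegment ℝ (pt u) (pt v) → p ∈ openSegment ℝ (pt u') (pt v') →
        s(u, v) = s(u', v')) :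
    IsPlanar G := by
  have hout : ∀ e : G.edgeSet, ∃ u v, G.Adj u v ∧ (e : Sym2 V) = s(u, v) := by
    rintro ⟨e, he⟩
    induction e using Sym2.ind with
    | _ u v => exact ⟨u, v, he, rfl⟩
  choose a b hab he using hout
  have hmem : ∀ (e : G.edgeSet) (t : unitInterval), t ∈ Set.Ioo 0 1 →
      AffineMap.lineMap (pt (a e)) (pt (b e)) (t : ℝ) ∈ openSegment ℝ (pt (a e)) (pt (b e)) := by
    intro e t ht
    rw [openSegment_eq_image_lineMap]
    exact ⟨t, ⟨ht.1, ht.2⟩, rfl⟩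
  refine ⟨{
    point := pt
    point_injective := hpt
    arc := fun e t => AffineMap.lineMap (pt (a e)) (pt (b e)) (t : ℝ)
    arc_continuous := fun e => AffineMap.lineMap_continuous.comp continuous_subtype_val
    arc_injective := fun e => (AffineMap.lineMap_injective ℝ fun h => (hab e).ne (hpt h)).comp
      Subtype.val_injective
    arc_ends := fun e => by simp [he e]
    arc_ne_point := fun e t ht v h => hvertex _ _ (hab e) v (h ▸ hmem e t ht)
    arc_ne_arc := fun e f hef t u ht hu h => hef <| Subtype.ext <| by
      rw [he e, he f]
      exact hedge _ _ _ _ (hab e) (hab f) _ (hmem e t ht) (h ▸ hmem f u hu) }⟩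

/-- The positions of the vertices in the drawing of `edgeJoinPath N`. -/
def drawPoint {N : ℕ} : Bool ⊕ Fin N → ℝ × ℝ
  | .inl true => (0, 1)
  | .inl false => (0, -1)
  | .inr w => ((w : ℝ) + 1, 0)

/-- The point `p` lies in the interior of the edge `e` in the drawing of `edgeJoinPath N`. -/
inductive LiesOn {N : ℕ} (p : ℝ × ℝ) : Sym2 (Bool ⊕ Fin N) → Prop
  | center (hx : p.1 = 0) (h1 : -1 < p.2) (h2 : p.2 < 1) : LiesOn p s(.inl true, .inl false)
  | upper (w : Fin N) (h1 : 0 < p.2) (h2 : p.2 < 1) (hx : p.1 = (1 - p.2) * (w + 1)) :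
      LiesOn p s(.inl true, .inr w)
  | lower (w : Fin N) (h1 : p.2 < 0) (h2 : -1 < p.2) (hx : p.1 = (1 + p.2) * (w + 1)) :
      LiesOn p s(.inl false, .inr w)
  | path (v w : Fin N) (hvw : (v : ℕ) + 1 = w) (hy : p.2 = 0) (h1 : (v : ℝ) + 1 < p.1)
      (h2 : p.1 < (v : ℝ) + 2) : LiesOn p s(.inr v, .inr w)

theorem liesOn_of_mem_openSegment {N : ℕ} {u v : Bool ⊕ Fin N} (huv : (edgeJoinPath N).Adj u v)
    {p : ℝ × ℝ} (hp : p ∈ openSegment ℝ (drawPoint u) (drawPoint v)) : LiesOn p s(u, v) := by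
  -- The three conditions orient the edge as in the constructors of `LiesOn`: `true` before `false`,
  -- edge ends before path vertices, left to right along the path. Other orientations follow by
  -- `swap`.
  have main : ∀ u v : Bool ⊕ Fin N, (edgeJoinPath N).Adj u v →
      (∀ a b, u = .inl a → v = .inl b → a = true) → (∀ a w, u = .inr w → v ≠ .inl a) →
      (∀ i j : Fin N, u = .inr i → v = .inr j → (i : ℕ) + 1 = j) →
      p ∈ openSegment ℝ (drawPoint u) (drawPoint v) → LiesOn p s(u, v) := by
    rintro ((_ | _) | i) ((_ | _) | j) huv h1 h2 h3 ⟨a, b, ha, hb, hab, rfl⟩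
    · exact absurd rfl huv
    · cases h1 _ _ rfl rfl
    · obtain rfl : b = 1 - a := by linarith
      refine .lower j ?_ ?_ ?_ <;> simp [drawPoint, ← sub_eq_add_neg] <;> linarith
    · refine .center ?_ ?_ ?_ <;> simp [drawPoint] <;> linarith
    · exact absurd rfl huv
    · obtain rfl : b = 1 - a := by linarith
      refine .upper j ?_ ?_ ?_ <;> simp [drawPoint] <;> linarith
    · exact absurd rfl (h2 _ _ rfl)
    · exact absurd rfl (h2 _ _ rfl)
    · have hij := h3 _ _ rfl rfl
      have hj : (j : ℝ) = i + 1 := by exact_mod_cast hij.symm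
      obtain rfl : b = 1 - a := by linarith
      refine .path i j hij ?_ ?_ ?_ <;> simp [drawPoint, hj] <;> nlinarith
  have swap := fun h1 h2 h3 => Sym2.eq_swap (a := v) (b := u) ▸
    main v u huv.symm h1 h2 h3 (openSegment_symm ℝ (drawPoint u) (drawPoint v) ▸ hp)
  rcases u with a | i <;> rcases v with b | j
  · cases a with
    | true => exact main _ _ huv (by simp) (by simp) (by simp) hp
    | false =>
      cases b with
      | true => exact swap (by simp) (by simp) (by simp)
      | false => exact absurd rfl huv
  · exact main _ _ huv (by simp) (by simp) (by simp) hp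
  · exact swap (by simp) (by simp) (by simp)
  · rcases huv with h | h
    · exact main _ _ (Or.inl h) (by simp) (by simp) (by simpa using h) hp
    · exact swap (by simp) (by simp) (by simpa using h)

/-- The sign of `p.2` separates upper and lower edges from the horizontal axis, and `p.1 = 0` holds
only on the central edge. On a slanted edge `p.1 / (1 ∓ p.2)` recovers `w + 1`; on the path, `p.1`
lies in a single open unit interval. -/
theorem LiesOn.unique {N : ℕ} {p : ℝ × ℝ} {e f : Sym2 (Bool ⊕ Fin N)} (he : LiesOn p e)
    (hf : LiesOn p f) : e = f := by
  have hpos : ∀ w : Fin N, (0 : ℝ) < w + 1 := fun w => by positivity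
  have hcancel : ∀ {c : ℝ} {v w : Fin N}, 0 < c → c * (v + 1) = c * (w + 1) → v = w := by
    intro c v w hc h
    have := mul_left_cancel₀ hc.ne' h
    exact Fin.ext (by exact_mod_cast add_right_cancel this)
  cases he with
  | center hx h1 h2 =>
    cases hf with
    | center => rfl
    | upper w h3 h4 hx' => nlinarith [mul_pos (sub_pos.2 h4) (hpos w)]
    | lower w h3 h4 hx' => nlinarith [mul_pos (neg_lt_iff_pos_add'.1 h4) (hpos w)]
    | path v w hvw hy h3 h4 => linarith [hpos v]
  | upper w h1 h2 hx =>
    cases hf with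
    | center hx' => nlinarith [mul_pos (sub_pos.2 h2) (hpos w)]
    | upper w' h3 h4 hx' => rw [hcancel (sub_pos.2 h2) (hx.symm.trans hx')]
    | lower => linarith
    | path => linarith
  | lower w h1 h2 hx =>
    cases hf with
    | center hx' => nlinarith [mul_pos (neg_lt_iff_pos_add'.1 h2) (hpos w)]
    | upper => linarith
    | lower w' h3 h4 hx' => rw [hcancel (neg_lt_iff_pos_add'.1 h2) (hx.symm.trans hx')]
    | path => linarith
  | path v w hvw hy h1 h2 =>
    cases hf with
    | center => linarith [hpos v]
    | upper => linarith
    | lower => linarith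
    | path v' w' hvw' hy' h3 h4 =>
      have h5 : (v : ℝ) < v' + 1 := by linarith
      have h6 : (v' : ℝ) < v + 1 := by linarith
      have h7 : (v : ℕ) < v' + 1 := by exact_mod_cast h5
      have h8 : (v' : ℕ) < v + 1 := by exact_mod_cast h6
      obtain rfl : v = v' := Fin.ext (by omega)
      obtain rfl : w = w' := Fin.ext (by omega)
      rfl

theorem not_liesOn_drawPoint {N : ℕ} (u : Bool ⊕ Fin N) (e : Sym2 (Bool ⊕ Fin N)) :
    ¬LiesOn (drawPoint u) e := by
  intro h
  rcases u with (_ | _) | i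
  · cases h <;> simp_all [drawPoint]; linarith
  · cases h <;> simp_all [drawPoint]; linarith
  · cases h with
    | center hx => exact (by positivity : (i : ℝ) + 1 ≠ 0) hx
    | upper w h1 => exact lt_irrefl _ h1
    | lower w h1 => exact lt_irrefl _ h1
    | path v w hvw hy h1 h2 =>
      simp only [drawPoint] at h1 h2
      have h3 : (v : ℝ) < i := by linarith
      have h4 : (i : ℝ) < v + 1 := by linarith
      have h5 : (v : ℕ) < i := by exact_mod_cast h3
      have h6 : (i : ℕ) < v + 1 := by exact_mod_cast h4
      omega

theorem drawPoint_injective (N : ℕ) : Function.Injective (drawPoint (N := N)) := by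
  rintro ((_ | _) | i) ((_ | _) | j) h <;> simp only [drawPoint, Prod.mk.injEq] at h
  · rfl
  · norm_num at h
  · norm_num at h
  · norm_num at h
  · rfl
  · norm_num at h
  · norm_num at h
  · norm_num at h
  · exact congrArg _ (Fin.ext (by exact_mod_cast add_right_cancel h.1))

theorem isPlanar_edgeJoinPath (N : ℕ) : IsPlanar (edgeJoinPath N) :=
  isPlanar_of_segments drawPoint (drawPoint_injective N)
    (fun _ _ huv w hw => not_liesOn_drawPoint w _ (liesOn_of_mem_openSegment huv hw))
    (fun _ _ _ _ huv huv' _ hp hp' =>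
      (liesOn_of_mem_openSegment huv hp).unique (liesOn_of_mem_openSegment huv' hp'))

theorem exists_planar_hatGuessingNumber_ge :
    ∃ (V : Type) (_ : Finite V) (G : SimpleGraph V),
      IsPlanar G ∧ 22 ≤ hatGuessingNumber 1 G := by
  obtain ⟨q, hq⟩ := exists_isPathRule
  obtain ⟨N, hN⟩ := isWinningGame_edgeJoinPath hq
  exact ⟨Bool ⊕ Fin N, inferInstance, edgeJoinPath N, isPlanar_edgeJoinPath N,
    le_iSup₂_of_le (f := fun (k : ℕ) (_ : IsWinningGame (edgeJoinPath N) (fun _ => k) fun _ => 1) =>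
      (k : ℕ∞)) 22 hN le_rfl⟩

end HatGuessing

theorem mainTheorem1 :
    (∃ (V : Type) (_ : Finite V) (G : SimpleGraph V),
      HatGuessing.IsPlanar G ∧ 22 ≤ HatGuessing.hatGuessingNumber 1 G) ∧
    22 ≤ HatGuessing.hatGuessingNumberOfClass 1 (fun _ G => HatGuessing.IsPlanar G) := by
  have h := HatGuessing.exists_planar_hatGuessingNumber_ge
  refine ⟨h, ?_⟩
  obtain ⟨V, hV, G, hG, hle⟩ := h
  unfold HatGuessing.hatGuessingNumberOfClass
  exact hle.trans (le_iSup_of_le V (le_iSup_of_le hV (le_iSup_of_le G (le_iSup_of_le hG le_rfl))))
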